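/- For $1/2<\beta<1$ let $\rho^*(\beta)=\beta-\tfrac12$ if $\beta\le 3/4$ and $\rho^*(\beta)=(1-\sqrt{1-\beta})^2$ if $\beta>3/4$ (the detection boundary). Let $1/2<\beta<1$, $\rho^*(\beta)<r<1$, $a_1,a_2>0$ and $b_2>b_1>0$, and for $n\ge 2$ set $$\Omega_n=\Big\{(\varepsilon,\mu)\in\mathbb R^2:\ b_1n^{-\beta}\le\varepsilon\le b_2n^{-\beta},\ \sqrt{2r\log n}-\frac{a_1}{\log n}\le\mu\le\sqrt{2r\log n}+\frac{a_2}{\log n}\Big\}.$$ Then there is a constant $C>0$, depending only on $r,\beta,a_1,a_2,b_1,b_2$, such that for every $n\ge 2$ with $b_2n^{-\beta}\le 1$ (in particular, for all sufficiently large $n$), $$\inf_{\hat\varepsilon_n}\ \sup_{(\varepsilon,\mu)\in\Omega_n}E_{\varepsilon,\mu}\Big(\frac{\hat\varepsilon_n}{\varepsilon}-1\Big)^2\ \ge\ \begin{cases} C(\log n)\,n^{-1-2r+2\beta}, & \text{when }\beta\ge 3r,\\ C(\log n)^{5/2}\,n^{-1+(\beta+r)^2/(4r)}, & \text{when } r<\beta<3r,\\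 C\,n^{-1+\beta}, & \text{when }\beta\le r.\end{cases}$$ Here $E_{\varepsilon,\mu}$ is the expectation when $X_1,\dots,X_n$ are i.i.d. from the mixture $(1-\varepsilon)N(0,1)+\varepsilon N(\mu,1)$, and the infimum is over all estimators, that is, all measurable functions $\hat\varepsilon_n=\hat\varepsilon_n(X_1,\dots,X_n)$ with real values. -/

import Mathlib

open MeasureTheory ProbabilityTheory
open scoped ENNReal

noncomputable section

/-- The detection boundary `ρ*(β)` of the sparse normal mixture problem, for `1/2 < β < 1`. -/
def detectionBoundary (β : ℝ) : ℝ :=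
  if β ≤ 3 / 4 then β - 1 / 2 else (1 - Real.sqrt (1 - β)) ^ 2

/-- The two-point Gaussian mixture `(1 - ε) N(0, 1) + ε N(μ, 1)`, a probability measure
for `0 ≤ ε ≤ 1`. -/
def twoPointMixture (ε μ : ℝ) : Measure ℝ :=
  ENNReal.ofReal (1 - ε) • gaussianReal 0 1 + ENNReal.ofReal ε • gaussianReal μ 1

/-- The joint law of `n` independent observations from the mixture. -/
def sampleLaw (n : ℕ) (ε μ : ℝ) : Measure (Fin n → ℝ) :=
  Measure.pi fun _ => twoPointMixture ε μ

/-- The local parameter set `Ω_n` of pairs `(ε, μ)`. -/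
def paramSet (r β a₁ a₂ b₁ b₂ : ℝ) (n : ℕ) : Set (ℝ × ℝ) :=
  {p | b₁ * (n : ℝ) ^ (-β) ≤ p.1 ∧ p.1 ≤ b₂ * (n : ℝ) ^ (-β) ∧
    Real.sqrt (2 * r * Real.log n) - a₁ / Real.log n ≤ p.2 ∧
    p.2 ≤ Real.sqrt (2 * r * Real.log n) + a₂ / Real.log n}

/-- The relative mean squared error `E (T(X₁, …, Xₙ) / ε - 1)²`, with values in `[0, ∞]`. -/
def relativeMSE (n : ℕ) (T : (Fin n → ℝ) → ℝ) (ε μ : ℝ) : ℝ≥0∞ :=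
  ∫⁻ x, ENNReal.ofReal ((T x / ε - 1) ^ 2) ∂(sampleLaw n ε μ)

/-- The minimax relative mean squared error over `Ω`: the infimum over all estimators
(measurable functions of the sample) of the worst-case risk. -/
def minimaxRelativeMSE (n : ℕ) (Ω : Set (ℝ × ℝ)) : ℝ≥0∞ :=
  ⨅ (T : (Fin n → ℝ) → ℝ) (_ : Measurable T), ⨆ p ∈ Ω, relativeMSE n T p.1 p.2

end

/-! This is Le Cam's two-point method. If two parameters of `Ω_n` have mixtures with `χ² = O(1/n)`,
the likelihood ratio of the samples has second moment at most `(1 + χ²)^n ≤ exp (n χ²) = O(1)`, so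
no test separates them and the risk is at least a constant times `(1 - ε₀/ε₁)²`
(`le_minimaxRelativeMSE`). It remains to change `ε` as much as this allows, starting from `ε = b₁
n^{-β}`, `μ = √(2r log n)`.

For `β ≤ r` only `ε` is scaled, by `1 + δ`. Then `χ² ≲ δ² ε`, so `δ² ≍ n^{-1+β}`.

Otherwise `ε` is raised while the mean drops by `t`, with `ε exp(μx - μ²/2)` kept fixed at a point
`x = κμ` where `χ²` would concentrate; the relative change of `ε` is then of order `tμ`. For `β ≥
3r`, `κ = 2` and `χ² ≲ ε² exp(μ²) t² + n^{-2β}`. For `r < β < 3r`, `κ = (β + r)/(2r)` marks where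
the two components balance; the weight decays there like `exp(-cμ|u|)`, so `χ² ≲ n^{-κ² r} t² / μ³ +
n^{-2β}`, and `t² μ²` gains the factor `μ⁵ ≍ (log n)^{5/2}`. The detection boundary makes `t` decay
as a power of `n`, which keeps the second point in `Ω_n`. -/

/-! ### Product densities and testing with a bounded second moment -/

theorem lintegral_pi_prod_eq_prod {α : Type*} [MeasurableSpace α] (μ : Measure α) [SigmaFinite μ] :
    ∀ {n : ℕ} {f : Fin n → α → ℝ≥0∞}, (∀ i, Measurable (f i)) →
      ∫⁻ x, ∏ i, f i (x i) ∂(Measure.pi fun _ : Fin n => μ) = ∏ i, ∫⁻ y, f i y ∂μ := by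
  intro n
  induction n with
  | zero => intro f _; simp
  | succ n ih =>
    intro f hf
    have e := (measurePreserving_piFinSuccAbove (fun _ : Fin (n + 1) => μ) 0).symm
    have hm : Measurable fun x : Fin (n + 1) → α => ∏ i, f i (x i) :=
      Finset.measurable_prod _ fun i _ => (hf i).comp (measurable_pi_apply i)
    rw [← e.lintegral_comp hm]
    simp_rw [MeasurableEquiv.piFinSuccAbove_symm_apply, Fin.insertNthEquiv,
      Fin.prod_univ_succ, Fin.insertNth_zero]
    simp only [Equiv.coe_fn_mk, Fin.cons_zero, Fin.cons_succ, cast_eq]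
    have hg : Measurable fun z : Fin n → α => ∏ i : Fin n, f i.succ (z i) :=
      Finset.measurable_prod _ fun i _ => (hf i.succ).comp (measurable_pi_apply i)
    rw [← ih fun i => hf i.succ]
    exact lintegral_prod_mul (hf 0).aemeasurable hg.aemeasurable

theorem pi_withDensity_eq {α : Type*} [MeasurableSpace α] (μ : Measure α) [SigmaFinite μ]
    (n : ℕ) {f : α → ℝ≥0∞} (hf : Measurable f) [SigmaFinite (μ.withDensity f)] :
    (Measure.pi fun _ : Fin n => μ.withDensity f) =
      (Measure.pi fun _ : Fin n => μ).withDensity fun x => ∏ i, f (x i) := by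
  refine Measure.pi_eq fun s hs => ?_
  rw [withDensity_apply _ (MeasurableSet.univ_pi hs),
    ← lintegral_indicator (MeasurableSet.univ_pi hs)]
  have : ((Set.univ.pi s).indicator fun x : Fin n → α => ∏ i, f (x i)) =
      fun x => ∏ i, (s i).indicator f (x i) := by
    funext x
    by_cases hx : x ∈ Set.univ.pi s
    · rw [Set.indicator_of_mem hx]
      exact Finset.prod_congr rfl fun i _ => (Set.indicator_of_mem (hx i trivial) f).symm
    · rw [Set.indicator_of_notMem hx]
      simp only [Set.mem_pi, Set.mem_univ, true_imp_iff, not_forall] at hx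
      obtain ⟨i, hi⟩ := hx
      exact (Finset.prod_eq_zero (Finset.mem_univ i) (Set.indicator_of_notMem hi f)).symm
  rw [this, lintegral_pi_prod_eq_prod μ fun i => hf.indicator (hs i)]
  exact Finset.prod_congr rfl fun i _ => by
    rw [lintegral_indicator (hs i), withDensity_apply _ (hs i)]

theorem ennreal_le_add_sq {K : ℝ} (hK : 0 < K) (L : ℝ≥0∞) :
    L ≤ ENNReal.ofReal K + ENNReal.ofReal (1 / (4 * K)) * L ^ 2 := by
  induction L using ENNReal.recTopCoe with
  | top =>
    have : ENNReal.ofReal (1 / (4 * K)) ≠ 0 := by simpa using hK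
    rw [ENNReal.top_pow two_ne_zero, ENNReal.mul_top this]; simp
  | coe x =>
    rw [← ENNReal.ofReal_coe_nnreal, ← ENNReal.ofReal_pow x.coe_nonneg, ← ENNReal.ofReal_mul (by positivity),
      ← ENNReal.ofReal_add hK.le (by positivity)]
    apply ENNReal.ofReal_le_ofReal
    have : K + 1 / (4 * K) * (x : ℝ) ^ 2 - x = (2 * K - x) ^ 2 / (4 * K) := by field_simp; ring
    have : 0 ≤ (2 * K - (x : ℝ)) ^ 2 / (4 * K) := by positivity
    linarith

/-- If the likelihood ratio has bounded second moment, no test separates the two measures. -/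
theorem le_measure_or_le_measure_compl {X : Type*} [MeasurableSpace X] {P Q : Measure X}
    [IsProbabilityMeasure Q] {L : X → ℝ≥0∞} (hL : Measurable L)
    (hQ : Q = P.withDensity L) {K : ℝ} (hK : 0 < K) (hLK : ∫⁻ x, L x ^ 2 ∂P ≤ ENNReal.ofReal K)
    {A : Set X} (hA : MeasurableSet A) :
    ENNReal.ofReal (1 / (4 * K)) ≤ P A ∨ ENNReal.ofReal (1 / 2) ≤ Q Aᶜ := by
  by_contra! h
  obtain ⟨h1, h2⟩ := h
  -- Integrating `L ≤ K + L²/(4K)` over `A` gives two terms, each at most `1/4`.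
  have hQA : Q A ≤ ENNReal.ofReal (1 / 2) := by
    calc Q A = ∫⁻ x in A, L x ∂P := by rw [hQ, withDensity_apply _ hA]
      _ ≤ ∫⁻ x in A, (ENNReal.ofReal K + ENNReal.ofReal (1 / (4 * K)) * L x ^ 2) ∂P :=
          lintegral_mono fun x => ennreal_le_add_sq hK _
      _ = ENNReal.ofReal K * P A + ENNReal.ofReal (1 / (4 * K)) * ∫⁻ x in A, L x ^ 2 ∂P := by
          rw [lintegral_add_left measurable_const, lintegral_const,
            lintegral_const_mul _ (hL.pow_const 2), Measure.restrict_apply_univ]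
      _ ≤ ENNReal.ofReal K * ENNReal.ofReal (1 / (4 * K)) +
            ENNReal.ofReal (1 / (4 * K)) * ENNReal.ofReal K := by
          gcongr
          exact (setLIntegral_le_lintegral _ _).trans hLK
      _ = ENNReal.ofReal (1 / 2) := by
          rw [← ENNReal.ofReal_mul hK.le, ← ENNReal.ofReal_mul (by positivity),
            ← ENNReal.ofReal_add (by positivity) (by positivity)]
          congr 1; field_simp; norm_num
  have : Q A + Q Aᶜ < 1 := by
    calc Q A + Q Aᶜ < ENNReal.ofReal (1 / 2) + ENNReal.ofReal (1 / 2) :=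
          ENNReal.add_lt_add_of_le_of_lt (measure_ne_top Q A) hQA h2
      _ = 1 := by rw [← ENNReal.ofReal_add (by norm_num) (by norm_num)]; norm_num
  rw [measure_add_measure_compl hA, measure_univ] at this
  exact lt_irrefl _ this

/-! ### Mixture densities and the two-point bound -/

/-- The density of `twoPointMixture ε μ` with respect to `N(0, 1)`. -/
noncomputable def mixDensity (ε μ x : ℝ) : ℝ := 1 - ε + ε * Real.exp (μ * x - μ ^ 2 / 2)

theorem measurable_mixDensity (ε μ : ℝ) : Measurable (mixDensity ε μ) := by
  unfold mixDensity; fun_prop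

theorem mixDensity_pos {ε : ℝ} (h0 : 0 < ε) (h1 : ε ≤ 1) (μ x : ℝ) : 0 < mixDensity ε μ x := by
  have : 0 < ε * Real.exp (μ * x - μ ^ 2 / 2) := by positivity
  unfold mixDensity; linarith

theorem gaussianReal_eq_withDensity_exp (μ : ℝ) :
    gaussianReal μ 1 = (gaussianReal 0 1).withDensity
      fun x => ENNReal.ofReal (Real.exp (μ * x - μ ^ 2 / 2)) := by
  rw [gaussianReal_of_var_ne_zero μ one_ne_zero, gaussianReal_of_var_ne_zero 0 one_ne_zero,
    ← withDensity_mul _ (measurable_gaussianPDF _ _) (by fun_prop)]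
  congr 1
  funext x
  rw [Pi.mul_apply, gaussianPDF, gaussianPDF, ← ENNReal.ofReal_mul (gaussianPDFReal_nonneg _ _ _)]
  congr 1
  rw [gaussianPDFReal, gaussianPDFReal, mul_assoc _ (Real.exp _) (Real.exp _), ← Real.exp_add]
  congr 2
  push_cast; ring

theorem twoPointMixture_eq_withDensity {ε : ℝ} (h0 : 0 ≤ ε) (h1 : ε ≤ 1) (μ : ℝ) :
    twoPointMixture ε μ =
      (gaussianReal 0 1).withDensity fun x => ENNReal.ofReal (mixDensity ε μ x) := by
  have hm : Measurable fun x : ℝ => ENNReal.ofReal (Real.exp (μ * x - μ ^ 2 / 2)) := by fun_prop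
  have : (fun x => ENNReal.ofReal (mixDensity ε μ x)) =
      (fun _ => ENNReal.ofReal (1 - ε)) +
        ENNReal.ofReal ε • fun x => ENNReal.ofReal (Real.exp (μ * x - μ ^ 2 / 2)) := by
    funext x
    rw [Pi.add_apply, Pi.smul_apply, smul_eq_mul, ← ENNReal.ofReal_mul h0, mixDensity,
      ENNReal.ofReal_add (by linarith) (by positivity)]
  rw [this, withDensity_add_left measurable_const, withDensity_smul _ hm, withDensity_const,
    ← gaussianReal_eq_withDensity_exp, twoPointMixture]

theorem isProbabilityMeasure_twoPointMixture {ε : ℝ} (h0 : 0 ≤ ε) (h1 : ε ≤ 1) (μ : ℝ) :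
    IsProbabilityMeasure (twoPointMixture ε μ) := by
  constructor
  simp only [twoPointMixture, Measure.add_apply, Measure.smul_apply, measure_univ, smul_eq_mul,
    mul_one]
  rw [← ENNReal.ofReal_add (by linarith) h0]; simp

theorem lintegral_mixDensity {ε : ℝ} (h0 : 0 ≤ ε) (h1 : ε ≤ 1) (μ : ℝ) :
    ∫⁻ x, ENNReal.ofReal (mixDensity ε μ x) ∂(gaussianReal 0 1) = 1 := by
  have := isProbabilityMeasure_twoPointMixture h0 h1 μ
  have h := measure_univ (μ := twoPointMixture ε μ)
  rwa [twoPointMixture_eq_withDensity h0 h1, withDensity_apply _ MeasurableSet.univ,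
    Measure.restrict_univ] at h

theorem twoPointMixture_eq_withDensity_ratio {ε₀ ε₁ : ℝ} (h0 : 0 < ε₀) (h0' : ε₀ ≤ 1)
    (h1 : 0 ≤ ε₁) (h1' : ε₁ ≤ 1) (μ₀ μ₁ : ℝ) :
    twoPointMixture ε₁ μ₁ = (twoPointMixture ε₀ μ₀).withDensity
      fun x => ENNReal.ofReal (mixDensity ε₁ μ₁ x / mixDensity ε₀ μ₀ x) := by
  have m0 := measurable_mixDensity ε₀ μ₀
  have m1 := measurable_mixDensity ε₁ μ₁
  rw [twoPointMixture_eq_withDensity h0.le h0', twoPointMixture_eq_withDensity h1 h1',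
    ← withDensity_mul _ (by fun_prop) (by fun_prop)]
  congr 1
  funext x
  have hp := mixDensity_pos h0 h0' μ₀ x
  rw [Pi.mul_apply, ← ENNReal.ofReal_mul hp.le, mul_div_cancel₀ _ hp.ne']

/-- The second moment of the likelihood ratio in terms of the `χ²`-divergence. -/
theorem lintegral_ratio_sq_le {ε₀ ε₁ χ : ℝ} (h0 : 0 < ε₀) (h0' : ε₀ ≤ 1)
    (h1 : 0 < ε₁) (h1' : ε₁ ≤ 1) (μ₀ μ₁ : ℝ) (hχ0 : 0 ≤ χ)
    (hχ : ∫⁻ x, ENNReal.ofReal ((mixDensity ε₁ μ₁ x - mixDensity ε₀ μ₀ x) ^ 2 / mixDensity ε₀ μ₀ x)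
      ∂(gaussianReal 0 1) ≤ ENNReal.ofReal χ) :
    ∫⁻ x, ENNReal.ofReal (mixDensity ε₁ μ₁ x / mixDensity ε₀ μ₀ x) ^ 2 ∂(twoPointMixture ε₀ μ₀) ≤
      ENNReal.ofReal (1 + χ) := by
  have m0 := measurable_mixDensity ε₀ μ₀
  have m1 := measurable_mixDensity ε₁ μ₁
  rw [twoPointMixture_eq_withDensity h0.le h0',
    lintegral_withDensity_eq_lintegral_mul _ (by fun_prop) (by fun_prop)]
  -- With `g₀`, `g₁` the densities, `g₁²/g₀ + g₀ = (g₁ - g₀)²/g₀ + 2g₁`; adding the total mass of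
  -- `g₀` avoids subtraction in `ℝ≥0∞`.
  have key : (∫⁻ x, ((fun x => ENNReal.ofReal (mixDensity ε₀ μ₀ x)) *
        fun x => ENNReal.ofReal (mixDensity ε₁ μ₁ x / mixDensity ε₀ μ₀ x) ^ 2) x
          ∂(gaussianReal 0 1)) + 1 ≤ ENNReal.ofReal (1 + χ) + 1 := by
    calc _ = (∫⁻ x, ((fun x => ENNReal.ofReal (mixDensity ε₀ μ₀ x)) *
            fun x => ENNReal.ofReal (mixDensity ε₁ μ₁ x / mixDensity ε₀ μ₀ x) ^ 2) x
              ∂(gaussianReal 0 1)) +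
            ∫⁻ x, ENNReal.ofReal (mixDensity ε₀ μ₀ x) ∂(gaussianReal 0 1) := by
          rw [lintegral_mixDensity h0.le h0']
      _ = ∫⁻ x, (ENNReal.ofReal ((mixDensity ε₁ μ₁ x - mixDensity ε₀ μ₀ x) ^ 2 /
            mixDensity ε₀ μ₀ x) + (ENNReal.ofReal (mixDensity ε₁ μ₁ x) +
              ENNReal.ofReal (mixDensity ε₁ μ₁ x))) ∂(gaussianReal 0 1) := by
          rw [← lintegral_add_right _ (by fun_prop)]
          refine lintegral_congr fun x => ?_
          have p0 := mixDensity_pos h0 h0' μ₀ x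
          have p1 := mixDensity_pos h1 h1' μ₁ x
          rw [Pi.mul_apply, ← ENNReal.ofReal_pow (by positivity), ← ENNReal.ofReal_mul p0.le,
            ← ENNReal.ofReal_add (by positivity) p0.le, ← ENNReal.ofReal_add p1.le p1.le,
            ← ENNReal.ofReal_add (by positivity) (by positivity)]
          congr 1
          field_simp; ring
      _ ≤ ENNReal.ofReal χ + (1 + 1) := by
          rw [lintegral_add_right _ (by fun_prop), lintegral_add_right _ (by fun_prop),
            lintegral_mixDensity h1.le h1']
          gcongr
      _ = ENNReal.ofReal (1 + χ) + 1 := by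
          rw [ENNReal.ofReal_add zero_le_one hχ0, ENNReal.ofReal_one]; ring
  exact (ENNReal.add_le_add_iff_right ENNReal.one_ne_top).1 key

/-- The two-point lower bound: two parameters of `Ω` whose mixtures have `χ²`-divergence of order
`1 / n` bound the minimax risk from below. -/
theorem le_minimaxRelativeMSE {n : ℕ} {Ω : Set (ℝ × ℝ)} {ε₀ μ₀ ε₁ μ₁ χ K : ℝ}
    (hΩ0 : (ε₀, μ₀) ∈ Ω) (hΩ1 : (ε₁, μ₁) ∈ Ω) (h0 : 0 < ε₀) (h01 : ε₀ ≤ ε₁) (h1' : ε₁ ≤ 1)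
    (hχ0 : 0 ≤ χ) (hχK : n * χ ≤ K)
    (hχ : ∫⁻ x, ENNReal.ofReal ((mixDensity ε₁ μ₁ x - mixDensity ε₀ μ₀ x) ^ 2 / mixDensity ε₀ μ₀ x)
      ∂(gaussianReal 0 1) ≤ ENNReal.ofReal χ) :
    ENNReal.ofReal ((1 - ε₀ / ε₁) ^ 2 / (16 * Real.exp K)) ≤ minimaxRelativeMSE n Ω := by
  have h0' : ε₀ ≤ 1 := h01.trans h1'
  have h1 : 0 < ε₁ := h0.trans_le h01
  have hK0 : 0 ≤ K := (mul_nonneg n.cast_nonneg hχ0).trans hχK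
  have := isProbabilityMeasure_twoPointMixture h0.le h0' μ₀
  have := isProbabilityMeasure_twoPointMixture h1.le h1' μ₁
  have : IsProbabilityMeasure (sampleLaw n ε₁ μ₁) := by unfold sampleLaw; infer_instance
  have m0 := measurable_mixDensity ε₀ μ₀
  have m1 := measurable_mixDensity ε₁ μ₁
  let ℓ : ℝ → ℝ≥0∞ := fun x => ENNReal.ofReal (mixDensity ε₁ μ₁ x / mixDensity ε₀ μ₀ x)
  have hℓ : Measurable ℓ := by fun_prop
  have hratio : twoPointMixture ε₁ μ₁ = (twoPointMixture ε₀ μ₀).withDensity ℓ :=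
    twoPointMixture_eq_withDensity_ratio h0 h0' h1.le h1' μ₀ μ₁
  have hlaw : sampleLaw n ε₁ μ₁ = (sampleLaw n ε₀ μ₀).withDensity fun x => ∏ i, ℓ (x i) := by
    have : SigmaFinite ((twoPointMixture ε₀ μ₀).withDensity ℓ) := by rw [← hratio]; infer_instance
    rw [sampleLaw, sampleLaw, ← pi_withDensity_eq _ _ hℓ, ← hratio]
  have hL : Measurable fun x : Fin n → ℝ => ∏ i, ℓ (x i) :=
    Finset.measurable_prod _ fun i _ => hℓ.comp (measurable_pi_apply i)
  have hLK : ∫⁻ x, (∏ i, ℓ (x i)) ^ 2 ∂(sampleLaw n ε₀ μ₀) ≤ ENNReal.ofReal (Real.exp K) := by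
    simp_rw [← Finset.prod_pow]
    rw [sampleLaw, lintegral_pi_prod_eq_prod (f := fun _ x => ℓ x ^ 2) _
      fun _ => hℓ.pow_const 2, Finset.prod_const, Finset.card_univ, Fintype.card_fin]
    calc _ ≤ ENNReal.ofReal (1 + χ) ^ n := by
          gcongr; exact lintegral_ratio_sq_le h0 h0' h1 h1' μ₀ μ₁ hχ0 hχ
      _ = ENNReal.ofReal ((1 + χ) ^ n) := (ENNReal.ofReal_pow (by positivity) n).symm
      _ ≤ ENNReal.ofReal (Real.exp K) := by
          apply ENNReal.ofReal_le_ofReal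
          calc (1 + χ) ^ n ≤ Real.exp χ ^ n := by
                gcongr; linarith [Real.add_one_le_exp χ]
            _ = Real.exp (n * χ) := (Real.exp_nat_mul χ n).symm
            _ ≤ Real.exp K := Real.exp_le_exp.2 hχK
  refine le_iInf₂ fun T hT => ?_
  -- The estimator is turned into a test at the midpoint; being on the wrong side costs a relative
  -- error of at least `d` under either parameter.
  have hA : MeasurableSet {x | (ε₀ + ε₁) / 2 ≤ T x} := measurableSet_le measurable_const hT
  set d : ℝ := (1 - ε₀ / ε₁) / 2 with hd
  have hd0 : 0 ≤ d := by
    have : ε₀ / ε₁ ≤ 1 := (div_le_one h1).2 h01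
    rw [hd]; linarith
  have hexp : 1 ≤ Real.exp K := Real.one_le_exp hK0
  have bound : ∀ {S : Set (Fin n → ℝ)} {ε μ : ℝ}, MeasurableSet S → (ε, μ) ∈ Ω →
      (∀ x ∈ S, d ^ 2 ≤ (T x / ε - 1) ^ 2) →
      ENNReal.ofReal (1 / (4 * Real.exp K)) ≤ sampleLaw n ε μ S →
      ENNReal.ofReal ((1 - ε₀ / ε₁) ^ 2 / (16 * Real.exp K)) ≤
        ⨆ p ∈ Ω, relativeMSE n T p.1 p.2 := by
    intro S ε μ hS hmem hdS hm
    calc _ = ENNReal.ofReal (d ^ 2) * ENNReal.ofReal (1 / (4 * Real.exp K)) := by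
          rw [← ENNReal.ofReal_mul (by positivity)]; congr 1; rw [hd]; field_simp; ring
      _ ≤ ENNReal.ofReal (d ^ 2) * sampleLaw n ε μ S := by gcongr
      _ = ∫⁻ x in S, ENNReal.ofReal (d ^ 2) ∂(sampleLaw n ε μ) := by
          rw [setLIntegral_const]
      _ ≤ ∫⁻ x in S, ENNReal.ofReal ((T x / ε - 1) ^ 2) ∂(sampleLaw n ε μ) :=
          setLIntegral_mono' hS fun x hx => ENNReal.ofReal_le_ofReal (hdS x hx)
      _ ≤ relativeMSE n T ε μ := setLIntegral_le_lintegral _ _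
      _ ≤ _ := le_iSup₂ (f := fun (p : ℝ × ℝ) (_ : p ∈ Ω) => relativeMSE n T p.1 p.2) (ε, μ) hmem
  rcases le_measure_or_le_measure_compl hL hlaw (Real.exp_pos K) hLK hA with h | h
  · refine bound hA hΩ0 (fun x hx => pow_le_pow_left₀ hd0 ?_ 2) h
    have hx : (ε₀ + ε₁) / 2 ≤ T x := hx
    calc d = (ε₁ - ε₀) / 2 / ε₁ := by rw [hd]; field_simp
      _ ≤ (ε₁ - ε₀) / 2 / ε₀ := div_le_div_of_nonneg_left (by linarith) h0 h01
      _ ≤ (T x - ε₀) / ε₀ := by gcongr; linarith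
      _ = T x / ε₀ - 1 := by field_simp
  · refine bound hA.compl hΩ1 (fun x hx => ?_) (le_trans ?_ h)
    · have hx : T x < (ε₀ + ε₁) / 2 := not_le.1 hx
      rw [← neg_sq (T x / ε₁ - 1)]
      refine pow_le_pow_left₀ hd0 ?_ 2
      calc d = (ε₁ - ε₀) / 2 / ε₁ := by rw [hd]; field_simp
        _ ≤ (ε₁ - T x) / ε₁ := by gcongr; linarith
        _ = -(T x / ε₁ - 1) := by field_simp; ring
    · apply ENNReal.ofReal_le_ofReal
      rw [div_le_div_iff₀ (by positivity) (by norm_num)]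
      linarith

/-! ### Bounds on the `χ²`-divergence -/

theorem exp_sub_one_sq_le (y : ℝ) : (Real.exp y - 1) ^ 2 ≤ y ^ 2 * Real.exp (2 * |y|) := by
  have h : |Real.exp y - 1| ≤ |y| * Real.exp |y| := by
    rcases le_total 0 y with hy | hy
    · have h1 : 0 ≤ Real.exp y - 1 := by linarith [Real.add_one_le_exp y]
      rw [abs_of_nonneg h1, abs_of_nonneg hy]
      have h2 := Real.add_one_le_exp (-y)
      have h3 : Real.exp (-y) * Real.exp y = 1 := by rw [← Real.exp_add]; simp
      nlinarith [Real.exp_pos y]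
    · have h1 : Real.exp y - 1 ≤ 0 := by linarith [Real.exp_le_one_iff.2 hy]
      rw [abs_of_nonpos h1, abs_of_nonpos hy]
      have h2 := Real.add_one_le_exp y
      have h3 : 1 ≤ Real.exp (-y) := Real.one_le_exp (by linarith)
      nlinarith
  calc (Real.exp y - 1) ^ 2 = |Real.exp y - 1| ^ 2 := (sq_abs _).symm
    _ ≤ (|y| * Real.exp |y|) ^ 2 := by gcongr
    _ = y ^ 2 * Real.exp (2 * |y|) := by
      rw [mul_pow, sq_abs, ← Real.exp_nat_mul]; norm_num

theorem lintegral_sq_mul_exp_neg_mul_abs {a : ℝ} (ha : 0 < a) :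
    ∫⁻ u : ℝ, ENNReal.ofReal (u ^ 2 * Real.exp (-a * |u|)) = ENNReal.ofReal (4 / a ^ 3) := by
  have hI : ∫ u : ℝ, u ^ 2 * Real.exp (-a * |u|) = 4 / a ^ 3 := by
    have h1 := integral_comp_abs (f := fun u : ℝ => u ^ 2 * Real.exp (-a * u))
    simp only [sq_abs] at h1
    rw [h1]
    have h2 := Real.integral_rpow_mul_exp_neg_mul_Ioi (a := 3) (r := a) (by norm_num) ha
    have h3 : ∫ u in Set.Ioi (0 : ℝ), u ^ 2 * Real.exp (-a * u) =
        ∫ u in Set.Ioi (0 : ℝ), u ^ ((3 : ℝ) - 1) * Real.exp (-(a * u)) := by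
      refine integral_congr_ae (Filter.Eventually.of_forall fun u => ?_)
      norm_num
    have h4 : Real.Gamma 3 = 2 := by
      rw [show (3 : ℝ) = ((2 : ℕ) : ℝ) + 1 by norm_num, Real.Gamma_nat_eq_factorial]
      norm_num
    rw [h3, h2, h4, show (3 : ℝ) = ((3 : ℕ) : ℝ) by norm_num, Real.rpow_natCast]
    field_simp; norm_num
  have hint : Integrable fun u : ℝ => u ^ 2 * Real.exp (-a * |u|) := by
    refine Integrable.of_integral_ne_zero ?_
    rw [hI]; positivity
  rw [← hI, ofReal_integral_eq_lintegral_ofReal hint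
    (Filter.Eventually.of_forall fun u => by positivity)]

theorem lintegral_gaussianReal_eq (f : ℝ → ℝ≥0∞) (hf : Measurable f) (x₀ : ℝ) :
    ∫⁻ x, f x ∂(gaussianReal 0 1) =
      ∫⁻ u, ENNReal.ofReal (gaussianPDFReal 0 1 (x₀ + u)) * f (x₀ + u) := by
  rw [gaussianReal_of_var_ne_zero 0 one_ne_zero,
    lintegral_withDensity_eq_lintegral_mul _ (measurable_gaussianPDF _ _) hf,
    ← lintegral_add_left_eq_self _ x₀]
  rfl

theorem gaussianPDFReal_zero_one_le (x : ℝ) : gaussianPDFReal 0 1 x ≤ Real.exp (-x ^ 2 / 2) := by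
  have h : (√(2 * Real.pi * ((1 : NNReal) : ℝ)))⁻¹ ≤ 1 := by
    refine inv_le_one_of_one_le₀ (Real.one_le_sqrt.2 ?_)
    push_cast
    linarith [Real.pi_gt_three]
  calc gaussianPDFReal 0 1 x = (√(2 * Real.pi * ((1 : NNReal) : ℝ)))⁻¹ * Real.exp (-x ^ 2 / 2) := by
        simp [gaussianPDFReal]
    _ ≤ 1 * Real.exp (-x ^ 2 / 2) := by gcongr
    _ = _ := one_mul _

/-- With this new proportion, `ε₁`, the densities differ by `ε exp(μx - μ²/2) (exp(-t(x - x₀)) - 1)`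
minus the constant `ε₁ - ε`. The first part vanishes at `x₀`, so under the decay `hbound` it
contributes the second moment of `exp(-a|u|)`, of order `t²/a³`. -/
theorem chiSq_shift_le {ε μ t x₀ q a B : ℝ} (h0 : 0 < ε) (hq : 0 < q) (hεq : ε ≤ 1 - q)
    (ha : 0 < a) (hB : 0 ≤ B)
    (hbound : ∀ u, Real.exp (-(x₀ + u) ^ 2 / 2) *
      ((ε * Real.exp (μ * (x₀ + u) - μ ^ 2 / 2)) ^ 2 / mixDensity ε μ (x₀ + u)) *
        Real.exp (2 * |t * u|) ≤ B * Real.exp (-a * |u|)) :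
    ∫⁻ x, ENNReal.ofReal
      ((mixDensity (ε * Real.exp (t * (x₀ - μ) + t ^ 2 / 2)) (μ - t) x - mixDensity ε μ x) ^ 2 /
        mixDensity ε μ x) ∂(gaussianReal 0 1) ≤
      ENNReal.ofReal (8 * B * t ^ 2 / a ^ 3 +
        2 * (ε * Real.exp (t * (x₀ - μ) + t ^ 2 / 2) - ε) ^ 2 / q) := by
  set ε₁ := ε * Real.exp (t * (x₀ - μ) + t ^ 2 / 2) with hε₁
  have m0 := measurable_mixDensity ε μ
  set F : ℝ → ℝ := fun x => 2 * ((ε * Real.exp (μ * x - μ ^ 2 / 2)) ^ 2 *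
    (Real.exp (-(t * (x - x₀))) - 1) ^ 2 / mixDensity ε μ x) with hF
  have mF : Measurable F := by fun_prop
  have hpos : ∀ x, 0 < mixDensity ε μ x := mixDensity_pos h0 (by linarith) μ
  have hF0 : ∀ x, 0 ≤ F x := fun x => by have := hpos x; positivity
  have hpt : ∀ x, (mixDensity ε₁ (μ - t) x - mixDensity ε μ x) ^ 2 / mixDensity ε μ x ≤
      F x + 2 * (ε₁ - ε) ^ 2 / q := by
    intro x
    have hg := hpos x
    have hgq : q ≤ mixDensity ε μ x := by
      have : 0 < ε * Real.exp (μ * x - μ ^ 2 / 2) := by positivity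
      unfold mixDensity; linarith
    have hdiff : mixDensity ε₁ (μ - t) x - mixDensity ε μ x =
        ε * Real.exp (μ * x - μ ^ 2 / 2) * (Real.exp (-(t * (x - x₀))) - 1) - (ε₁ - ε) := by
      have : ε₁ * Real.exp ((μ - t) * x - (μ - t) ^ 2 / 2) =
          ε * Real.exp (μ * x - μ ^ 2 / 2) * Real.exp (-(t * (x - x₀))) := by
        rw [hε₁, mul_assoc, mul_assoc, ← Real.exp_add, ← Real.exp_add]
        congr 2; ring
      unfold mixDensity
      linear_combination this
    rw [hdiff]
    calc _ ≤ (2 * (ε * Real.exp (μ * x - μ ^ 2 / 2) * (Real.exp (-(t * (x - x₀))) - 1)) ^ 2 +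
            2 * (ε₁ - ε) ^ 2) / mixDensity ε μ x := by
          gcongr
          nlinarith [sq_nonneg (ε * Real.exp (μ * x - μ ^ 2 / 2) *
            (Real.exp (-(t * (x - x₀))) - 1) + (ε₁ - ε))]
      _ = F x + 2 * (ε₁ - ε) ^ 2 / mixDensity ε μ x := by rw [hF]; ring
      _ ≤ _ := by gcongr
  have hFint : ∫⁻ x, ENNReal.ofReal (F x) ∂(gaussianReal 0 1) ≤
      ENNReal.ofReal (8 * B * t ^ 2 / a ^ 3) := by
    rw [lintegral_gaussianReal_eq _ (by fun_prop) x₀]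
    calc _ ≤ ∫⁻ u : ℝ, ENNReal.ofReal (2 * B * t ^ 2) *
          ENNReal.ofReal (u ^ 2 * Real.exp (-a * |u|)) := by
          refine lintegral_mono fun u => ?_
          rw [← ENNReal.ofReal_mul (gaussianPDFReal_nonneg _ _ _),
            ← ENNReal.ofReal_mul (by positivity)]
          apply ENNReal.ofReal_le_ofReal
          have hg := hpos (x₀ + u)
          have he := exp_sub_one_sq_le (-(t * u))
          rw [abs_neg, neg_sq] at he
          have hx : x₀ + u - x₀ = u := by ring
          calc _ ≤ Real.exp (-(x₀ + u) ^ 2 / 2) * F (x₀ + u) :=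
                mul_le_mul_of_nonneg_right (gaussianPDFReal_zero_one_le _) (hF0 _)
            _ = 2 * (Real.exp (-(x₀ + u) ^ 2 / 2) *
                ((ε * Real.exp (μ * (x₀ + u) - μ ^ 2 / 2)) ^ 2 / mixDensity ε μ (x₀ + u))) *
                  (Real.exp (-(t * u)) - 1) ^ 2 := by rw [hF]; simp only [hx]; ring
            _ ≤ 2 * (Real.exp (-(x₀ + u) ^ 2 / 2) *
                ((ε * Real.exp (μ * (x₀ + u) - μ ^ 2 / 2)) ^ 2 / mixDensity ε μ (x₀ + u))) *
                  ((t * u) ^ 2 * Real.exp (2 * |t * u|)) := by gcongr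
            _ = 2 * (t * u) ^ 2 * (Real.exp (-(x₀ + u) ^ 2 / 2) *
                ((ε * Real.exp (μ * (x₀ + u) - μ ^ 2 / 2)) ^ 2 / mixDensity ε μ (x₀ + u)) *
                  Real.exp (2 * |t * u|)) := by ring
            _ ≤ 2 * (t * u) ^ 2 * (B * Real.exp (-a * |u|)) :=
                mul_le_mul_of_nonneg_left (hbound u) (by positivity)
            _ = _ := by ring
      _ = ENNReal.ofReal (8 * B * t ^ 2 / a ^ 3) := by
          rw [lintegral_const_mul _ (by fun_prop), lintegral_sq_mul_exp_neg_mul_abs ha,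
            ← ENNReal.ofReal_mul (by positivity)]
          congr 1; ring
  calc _ ≤ ∫⁻ x, (ENNReal.ofReal (F x) + ENNReal.ofReal (2 * (ε₁ - ε) ^ 2 / q))
          ∂(gaussianReal 0 1) := by
        refine lintegral_mono fun x => ?_
        rw [← ENNReal.ofReal_add (hF0 x) (by positivity)]
        exact ENNReal.ofReal_le_ofReal (hpt x)
    _ ≤ _ := by
        rw [lintegral_add_right _ measurable_const, lintegral_const, measure_univ, mul_one,
          ENNReal.ofReal_add (by positivity) (by positivity)]
        gcongr

/-- Writing `L` for the Gaussian likelihood ratio and `g` for the mixture density, `εL ≤ g` gives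
`εL²/g ≤ L`, whose mean is 1. This saves a factor `ε` and needs no second moment of `L`. -/
theorem chiSq_scale_le {ε μ δ q : ℝ} (h0 : 0 < ε) (hq : 0 < q) (hεq : ε ≤ 1 - q) :
    ∫⁻ x, ENNReal.ofReal
      ((mixDensity (ε * (1 + δ)) μ x - mixDensity ε μ x) ^ 2 / mixDensity ε μ x)
        ∂(gaussianReal 0 1) ≤ ENNReal.ofReal (δ ^ 2 * ε * (1 + 1 / q)) := by
  have hpt : ∀ x, (mixDensity (ε * (1 + δ)) μ x - mixDensity ε μ x) ^ 2 / mixDensity ε μ x ≤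
      δ ^ 2 * ε * (Real.exp (μ * x - μ ^ 2 / 2) + 1 / q) := by
    intro x
    have hg := mixDensity_pos h0 (by linarith) μ x
    have hgd : mixDensity ε μ x = 1 - ε + ε * Real.exp (μ * x - μ ^ 2 / 2) := rfl
    have hdiff : mixDensity (ε * (1 + δ)) μ x - mixDensity ε μ x =
        δ * ε * (Real.exp (μ * x - μ ^ 2 / 2) - 1) := by unfold mixDensity; ring
    rw [hdiff]
    set L := Real.exp (μ * x - μ ^ 2 / 2)
    have hL : 0 < L := Real.exp_pos _
    rw [div_le_iff₀ hg]
    have h1 : ε * L ^ 2 ≤ L * mixDensity ε μ x := by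
      rw [hgd]; nlinarith [mul_nonneg (by linarith : (0 : ℝ) ≤ 1 - ε) hL.le]
    have h2 : ε ≤ 1 / q * mixDensity ε μ x := by
      rw [div_mul_eq_mul_div, one_mul, le_div_iff₀ hq, hgd]
      nlinarith [mul_pos h0 hL]
    calc (δ * ε * (L - 1)) ^ 2 = δ ^ 2 * ε * (ε * (L - 1) ^ 2) := by ring
      _ ≤ δ ^ 2 * ε * (ε * L ^ 2 + ε) := by gcongr; nlinarith [mul_pos h0 hL]
      _ ≤ δ ^ 2 * ε * (L * mixDensity ε μ x + 1 / q * mixDensity ε μ x) := by gcongr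
      _ = _ := by ring
  have hexp : ∫⁻ x, ENNReal.ofReal (Real.exp (μ * x - μ ^ 2 / 2)) ∂(gaussianReal 0 1) = 1 := by
    have h := measure_univ (μ := gaussianReal μ 1)
    rwa [gaussianReal_eq_withDensity_exp, withDensity_apply _ MeasurableSet.univ,
      Measure.restrict_univ] at h
  calc _ ≤ ∫⁻ x, ENNReal.ofReal (δ ^ 2 * ε) *
          (ENNReal.ofReal (Real.exp (μ * x - μ ^ 2 / 2)) + ENNReal.ofReal (1 / q))
          ∂(gaussianReal 0 1) := by
        refine lintegral_mono fun x => ?_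
        rw [← ENNReal.ofReal_add (by positivity) (by positivity),
          ← ENNReal.ofReal_mul (by positivity)]
        exact ENNReal.ofReal_le_ofReal (hpt x)
    _ = _ := by
        rw [lintegral_const_mul _ (by fun_prop), lintegral_add_right _ measurable_const, hexp,
          lintegral_const, measure_univ, mul_one, ← ENNReal.ofReal_one,
          ← ENNReal.ofReal_add (by norm_num) (by positivity), ← ENNReal.ofReal_mul (by positivity)]

/-! ### Admissible shifts of the mean -/

theorem exp_neg_mul_mul_sq_le {p : ℝ} (hp : 0 < p) {l : ℝ} (hl : 0 ≤ l) :
    Real.exp (-p * l) * (1 + l) ^ 2 ≤ (1 + 2 / p) ^ 2 := by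
  have h1 : 1 + l ≤ (1 + 2 / p) * Real.exp (p * l / 2) := by
    have h2 := Real.add_one_le_exp (p * l / 2)
    have h3 : 1 ≤ Real.exp (p * l / 2) := Real.one_le_exp (by positivity)
    have h4 : l ≤ 2 / p * Real.exp (p * l / 2) := by
      rw [div_mul_eq_mul_div, le_div_iff₀ hp]; linarith
    linarith
  calc _ ≤ Real.exp (-p * l) * ((1 + 2 / p) * Real.exp (p * l / 2)) ^ 2 := by gcongr
    _ = (1 + 2 / p) ^ 2 * (Real.exp (-p * l) * Real.exp (p * l / 2) ^ 2) := by ring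
    _ = (1 + 2 / p) ^ 2 := by
      rw [← Real.exp_nat_mul, ← Real.exp_add]
      norm_num [show -(p * l) + 2 * (p * l / 2) = 0 by ring]

/-- A small multiple of a rate `R` with `R (1 + log n)` bounded is an admissible shift of the
mean. -/
theorem exists_shift_scale {r a κ S τ M : ℝ} (hr0 : 0 < r) (hr1 : r < 1) (ha : 0 < a) (hκ : 1 < κ)
    (hS : 0 < S) (hτ : 0 < τ) (hM : 0 < M) :
    ∃ c : ℝ, 0 < c ∧ ∀ l R : ℝ, 0 < l → 0 < R → R * (1 + l) ≤ M →
      c * R ≤ τ ∧ c * R ≤ a / l ∧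
        c * R * ((κ - 1) * √(2 * r * l)) + (c * R) ^ 2 / 2 ≤ S := by
  have hκ' : 0 < 2 * (κ - 1) + 1 := by linarith
  -- The entries `τ`, `a` and the quotient serve the three conclusions in turn; the entry 1 allows
  -- `t²/2 ≤ m`.
  set m := min (min 1 τ) (min a (S / (2 * (κ - 1) + 1))) with hm
  have hm0 : 0 < m := by positivity
  have m1 : m ≤ 1 := (min_le_left _ _).trans (min_le_left _ _)
  have m2 : m ≤ τ := (min_le_left _ _).trans (min_le_right _ _)
  have m3 : m ≤ a := (min_le_right _ _).trans (min_le_left _ _)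
  have m4 : m * (2 * (κ - 1) + 1) ≤ S :=
    (le_div_iff₀ hκ').1 ((min_le_right _ _).trans (min_le_right _ _))
  refine ⟨m / M, by positivity, fun l R hl hR hRM => ?_⟩
  set t := m / M * R with ht
  have ht0 : 0 < t := by positivity
  have htl : t * (1 + l) ≤ m := by
    calc t * (1 + l) = m / M * (R * (1 + l)) := by rw [ht]; ring
      _ ≤ m / M * M := by gcongr
      _ = m := by field_simp
  have htm : t ≤ m := by nlinarith
  have hsqrt : √(2 * r * l) ≤ 2 * (1 + l) := by
    rw [Real.sqrt_le_left (by positivity)]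
    nlinarith [mul_pos hl hl]
  refine ⟨htm.trans m2, ?_, ?_⟩
  · rw [le_div_iff₀ hl]; nlinarith
  · have h1 : t * ((κ - 1) * √(2 * r * l)) ≤ (κ - 1) * (2 * m) := by
      calc _ = (κ - 1) * (t * √(2 * r * l)) := by ring
        _ ≤ (κ - 1) * (t * (2 * (1 + l))) := by
          have : 0 < κ - 1 := by linarith
          gcongr
        _ ≤ (κ - 1) * (2 * m) := by
          have : 0 < κ - 1 := by linarith
          exact mul_le_mul_of_nonneg_left (by linarith) this.le
    have h2 : t ^ 2 / 2 ≤ m := by nlinarith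
    linarith

theorem natCast_rpow_eq_exp {n : ℕ} (hn : 2 ≤ n) (x : ℝ) :
    (n : ℝ) ^ x = Real.exp (x * Real.log n) := by
  rw [Real.rpow_def_of_pos (by positivity), mul_comm]

/-- The two-point bound along a simultaneous change of the proportion and of the mean under which
the two mixtures agree at `κ * μ`. -/
theorem le_minimaxRelativeMSE_shift {r β a₁ a₂ b₁ b₂ κ t a B K ε μ : ℝ} {n : ℕ} (hn : 2 ≤ n)
    (hβ0 : 1 / 2 < β) (ha₁ : 0 < a₁) (ha₂ : 0 < a₂) (hb₁ : 0 < b₁) (hb : b₁ < b₂)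
    (hN : b₂ * (n : ℝ) ^ (-β) ≤ 1) (hε : ε = b₁ * (n : ℝ) ^ (-β))
    (hμ : μ = √(2 * r * Real.log n)) (hκ : 1 < κ) (ht : 0 < t) (hta : t ≤ a₁ / Real.log n)
    (hS : t * ((κ - 1) * μ) + t ^ 2 / 2 ≤ Real.log (b₂ / b₁)) (ha : 0 < a) (hB : 0 ≤ B)
    (hbound : ∀ u, Real.exp (-(κ * μ + u) ^ 2 / 2) *
      ((ε * Real.exp (μ * (κ * μ + u) - μ ^ 2 / 2)) ^ 2 / mixDensity ε μ (κ * μ + u)) *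
        Real.exp (2 * |t * u|) ≤ B * Real.exp (-a * |u|))
    (hK : n * (8 * B * t ^ 2 / a ^ 3) ≤ K) :
    ENNReal.ofReal ((b₁ / b₂ * (κ - 1)) ^ 2 / (16 * Real.exp (K + 2 * b₂ ^ 2 / (1 - b₁ / b₂))) *
      (t * μ) ^ 2) ≤ minimaxRelativeMSE n (paramSet r β a₁ a₂ b₁ b₂ n) := by
  have hb₂ : 0 < b₂ := hb₁.trans hb
  have hn1 : (1 : ℝ) < n := by exact_mod_cast (by omega : 1 < n)
  have hl : 0 < Real.log n := Real.log_pos hn1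
  have hnβ : 0 < (n : ℝ) ^ (-β) := by positivity
  have hε0 : 0 < ε := by rw [hε]; positivity
  have hq : 0 < 1 - b₁ / b₂ := by rw [sub_pos, div_lt_one hb₂]; exact hb
  have hεq : ε ≤ 1 - (1 - b₁ / b₂) := by
    calc ε = b₁ / b₂ * (b₂ * (n : ℝ) ^ (-β)) := by rw [hε]; field_simp
      _ ≤ b₁ / b₂ * 1 := by gcongr
      _ = _ := by ring
  have hμ0 : 0 ≤ μ := hμ ▸ Real.sqrt_nonneg _
  -- `s` is the logarithm of the ratio of the two proportions, forced by agreement at `κ * μ`.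
  set s := t * (κ * μ - μ) + t ^ 2 / 2 with hs
  have hs' : s = t * ((κ - 1) * μ) + t ^ 2 / 2 := by rw [hs]; ring
  have hκ1 : 0 < κ - 1 := by linarith
  have hs0 : 0 ≤ s := by rw [hs']; positivity
  have hes : Real.exp s ≤ b₂ / b₁ := by
    rw [← Real.exp_log (show 0 < b₂ / b₁ by positivity)]
    exact Real.exp_le_exp.2 (hs' ▸ hS)
  have hes1 : 1 ≤ Real.exp s := Real.one_le_exp hs0
  have hε1 : ε * Real.exp s ≤ b₂ * (n : ℝ) ^ (-β) := by
    calc ε * Real.exp s ≤ ε * (b₂ / b₁) := by gcongr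
      _ = _ := by rw [hε]; field_simp
  have hεle : ε ≤ ε * Real.exp s := le_mul_of_one_le_right hε0.le hes1
  have hchi := chiSq_shift_le hε0 hq hεq ha hB hbound
  refine le_trans (ENNReal.ofReal_le_ofReal ?_) (le_minimaxRelativeMSE
    (Ω := paramSet r β a₁ a₂ b₁ b₂ n) (K := K + 2 * b₂ ^ 2 / (1 - b₁ / b₂))
    ⟨hε.ge, hεle.trans hε1, ?_, ?_⟩ ⟨hε.ge.trans hεle, hε1, ?_, ?_⟩ hε0 hεle (hε1.trans hN)
    (by positivity) ?_ hchi)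
  · rw [div_mul_eq_mul_div, ← mul_pow]
    gcongr
    have h1 : ε / (ε * Real.exp s) = Real.exp (-s) := by
      rw [Real.exp_neg]; field_simp
    rw [h1]
    have h2 : b₁ / b₂ ≤ Real.exp (-s) := by
      rw [Real.exp_neg, ← inv_div b₂ b₁]
      exact inv_anti₀ (Real.exp_pos s) hes
    have h3 : Real.exp (-s) * s ≤ 1 - Real.exp (-s) := by
      have h4 : Real.exp (-s) * Real.exp s = 1 := by rw [← Real.exp_add]; simp
      nlinarith [Real.add_one_le_exp s, Real.exp_pos (-s)]
    calc b₁ / b₂ * (κ - 1) * (t * μ) ≤ b₁ / b₂ * s := by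
          rw [mul_assoc, hs']; gcongr; nlinarith [sq_nonneg t]
      _ ≤ Real.exp (-s) * s := by gcongr
      _ ≤ _ := h3
  · rw [← hμ]; have : 0 < a₁ / Real.log n := by positivity
    simp only; linarith
  · rw [← hμ]; have : 0 < a₂ / Real.log n := by positivity
    simp only; linarith
  · rw [← hμ]; simp only; linarith
  · rw [← hμ]; have : 0 < a₂ / Real.log n := by positivity
    simp only; linarith
  · rw [mul_add]
    refine add_le_add hK ?_
    have h1 : (ε * Real.exp s - ε) ^ 2 ≤ (b₂ * (n : ℝ) ^ (-β)) ^ 2 :=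
      pow_le_pow_left₀ (by linarith) (by linarith) 2
    -- Here `β > 1/2` makes the constant part of the perturbation invisible to `n` observations.
    have h2 : (n : ℝ) * ((n : ℝ) ^ (-β)) ^ 2 ≤ 1 := by
      have : (n : ℝ) = Real.exp (Real.log n) := (Real.exp_log (by linarith)).symm
      rw [natCast_rpow_eq_exp hn, ← Real.exp_nat_mul]
      nth_rewrite 1 [this]
      rw [← Real.exp_add, Real.exp_le_one_iff]
      push_cast; nlinarith
    calc (n : ℝ) * (2 * (ε * Real.exp s - ε) ^ 2 / (1 - b₁ / b₂)) ≤
          n * (2 * (b₂ * (n : ℝ) ^ (-β)) ^ 2 / (1 - b₁ / b₂)) := by gcongr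
      _ = n * ((n : ℝ) ^ (-β)) ^ 2 * (2 * b₂ ^ 2 / (1 - b₁ / b₂)) := by ring
      _ ≤ 1 * (2 * b₂ ^ 2 / (1 - b₁ / b₂)) := by gcongr
      _ = _ := one_mul _

/-! ### The bounds for the three regimes -/

theorem le_minimaxRelativeMSE_scale {r β a₁ a₂ b₁ b₂ : ℝ}
    (hβ1 : β < 1) (ha₁ : 0 < a₁) (ha₂ : 0 < a₂) (hb₁ : 0 < b₁) (hb : b₁ < b₂) :
    ∃ C : ℝ, 0 < C ∧ ∀ n : ℕ, 2 ≤ n → b₂ * (n : ℝ) ^ (-β) ≤ 1 →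
      ENNReal.ofReal (C * (n : ℝ) ^ (-1 + β)) ≤
        minimaxRelativeMSE n (paramSet r β a₁ a₂ b₁ b₂ n) := by
  have hb₂ : 0 < b₂ := hb₁.trans hb
  have hq : 0 < 1 - b₁ / b₂ := by rw [sub_pos, div_lt_one hb₂]; exact hb
  -- The largest relative increase from `b₁` that stays below `b₂`.
  set c := (b₂ - b₁) / b₁ with hc
  have hc0 : 0 < c := div_pos (by linarith) hb₁
  have hcb : 1 + c = b₂ / b₁ := by rw [hc]; field_simp; ring
  set K := c ^ 2 * b₁ * (1 + 1 / (1 - b₁ / b₂)) with hK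
  refine ⟨(b₁ / b₂ * c) ^ 2 / (16 * Real.exp K), by positivity, fun n hn hN => ?_⟩
  have hn1 : (1 : ℝ) < n := by exact_mod_cast (by omega : 1 < n)
  have hl : 0 < Real.log n := Real.log_pos hn1
  have hnβ : 0 < (n : ℝ) ^ (-β) := by positivity
  set ε := b₁ * (n : ℝ) ^ (-β) with hε
  have hε0 : 0 < ε := by rw [hε]; positivity
  have hεq : ε ≤ 1 - (1 - b₁ / b₂) := by
    calc ε = b₁ / b₂ * (b₂ * (n : ℝ) ^ (-β)) := by rw [hε]; field_simp
      _ ≤ b₁ / b₂ * 1 := by gcongr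
      _ = _ := by ring
  set R := (n : ℝ) ^ ((-1 + β) / 2) with hR
  have hR0 : 0 < R := by positivity
  have hR1 : R ≤ 1 := Real.rpow_le_one_of_one_le_of_nonpos hn1.le (by linarith)
  have hR2 : R ^ 2 = (n : ℝ) ^ (-1 + β) := by
    rw [hR, ← Real.rpow_natCast, ← Real.rpow_mul (by positivity)]; congr 1; push_cast; ring
  have hδc : c * R ≤ c := mul_le_of_le_one_right hc0.le hR1
  have hεle : ε ≤ ε * (1 + c * R) := le_mul_of_one_le_right hε0.le (by linarith [mul_pos hc0 hR0])
  have hε1 : ε * (1 + c * R) ≤ b₂ * (n : ℝ) ^ (-β) := by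
    calc ε * (1 + c * R) ≤ ε * (b₂ / b₁) := by rw [← hcb]; gcongr
      _ = _ := by rw [hε]; field_simp
  have hm1 : 0 < a₁ / Real.log n := by positivity
  have hm2 : 0 < a₂ / Real.log n := by positivity
  refine le_trans (ENNReal.ofReal_le_ofReal ?_) (le_minimaxRelativeMSE
    (Ω := paramSet r β a₁ a₂ b₁ b₂ n) (K := K) (μ₀ := √(2 * r * Real.log n))
    ⟨le_rfl, hεle.trans hε1, by simp only; linarith, by simp only; linarith⟩
    ⟨hεle, hε1, by simp only; linarith, by simp only; linarith⟩ hε0 hεle (hε1.trans hN)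
    (by positivity) ?_ (chiSq_scale_le (δ := c * R) hε0 hq hεq))
  · rw [← hR2, div_mul_eq_mul_div, ← mul_pow]
    gcongr
    have h1 : 1 - ε / (ε * (1 + c * R)) = c * R / (1 + c * R) := by
      have : 0 < 1 + c * R := by positivity
      field_simp; ring
    rw [h1, ← inv_div b₂ b₁, ← hcb, mul_assoc, inv_mul_eq_div]
    gcongr
  · have h1 : (n : ℝ) * R ^ 2 * (n : ℝ) ^ (-β) = 1 := by
      have h2 : (n : ℝ) = (n : ℝ) ^ (1 : ℝ) := (Real.rpow_one _).symm
      rw [hR2]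
      nth_rewrite 1 [h2]
      rw [← Real.rpow_add (by linarith), ← Real.rpow_add (by linarith),
        show (1 : ℝ) + (-1 + β) + -β = 0 by ring, Real.rpow_zero]
    apply le_of_eq
    calc _ = n * R ^ 2 * (n : ℝ) ^ (-β) * (c ^ 2 * b₁ * (1 + 1 / (1 - b₁ / b₂))) := by
          rw [hε]; ring
      _ = K := by rw [h1, one_mul]

theorem le_minimaxRelativeMSE_sparse {r β a₁ a₂ b₁ b₂ : ℝ} (hr0 : 0 < r) (hr1 : r < 1)
    (hβ0 : 1 / 2 < β) (hrβ : β - 1 / 2 < r) (ha₁ : 0 < a₁) (ha₂ : 0 < a₂) (hb₁ : 0 < b₁)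
    (hb : b₁ < b₂) :
    ∃ C : ℝ, 0 < C ∧ ∀ n : ℕ, 2 ≤ n → b₂ * (n : ℝ) ^ (-β) ≤ 1 →
      ENNReal.ofReal (C * Real.log n * (n : ℝ) ^ (-1 - 2 * r + 2 * β)) ≤
        minimaxRelativeMSE n (paramSet r β a₁ a₂ b₁ b₂ n) := by
  have hb₂ : 0 < b₂ := hb₁.trans hb
  have hq : 0 < 1 - b₁ / b₂ := by rw [sub_pos, div_lt_one hb₂]; exact hb
  -- The exponent that makes `n ε² exp(μ²) t²` constant for `t = c n^{-p}`.
  set p := (1 - 2 * β + 2 * r) / 2 with hp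
  have hp0 : 0 < p := by rw [hp]; linarith
  obtain ⟨c, hc, hc'⟩ := exists_shift_scale (κ := 2) (S := Real.log (b₂ / b₁)) (τ := 1)
    (M := (1 + 2 / p) ^ 2) hr0 hr1 ha₁ (by norm_num)
    (Real.log_pos ((one_lt_div hb₁).2 hb)) one_pos (by positivity)
  set q := 1 - b₁ / b₂ with hqdef
  set K := 8 * (b₁ ^ 2 / q * Real.exp (9 / 2)) * c ^ 2 with hK
  set c₀ := (b₁ / b₂ * (2 - 1)) ^ 2 / (16 * Real.exp (K + 2 * b₂ ^ 2 / q)) with hc₀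
  have hc₀0 : 0 < c₀ := by rw [hc₀]; positivity
  refine ⟨c₀ * (c ^ 2 * (2 * r)), by positivity, fun n hn hN => ?_⟩
  have hn1 : (1 : ℝ) < n := by exact_mod_cast (by omega : 1 < n)
  have hl : 0 < Real.log n := Real.log_pos hn1
  have hne : (n : ℝ) = Real.exp (Real.log n) := (Real.exp_log (by linarith)).symm
  set l := Real.log n with hldef
  set μ := √(2 * r * l) with hμ
  have hμ2 : μ ^ 2 = 2 * r * l := Real.sq_sqrt (by positivity)
  set ε := b₁ * (n : ℝ) ^ (-β) with hε
  have hnβ : 0 < (n : ℝ) ^ (-β) := by positivity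
  have hε0 : 0 < ε := by rw [hε]; positivity
  have hε1 : ε ≤ 1 - q := by
    calc ε = b₁ / b₂ * (b₂ * (n : ℝ) ^ (-β)) := by rw [hε]; field_simp
      _ ≤ b₁ / b₂ * 1 := by gcongr
      _ = _ := by rw [hqdef]; ring
  have hR : Real.exp (-p * l) * (1 + l) ≤ (1 + 2 / p) ^ 2 :=
    le_trans (mul_le_mul_of_nonneg_left (by nlinarith) (Real.exp_pos _).le)
      (exp_neg_mul_mul_sq_le hp0 hl.le)
  obtain ⟨ht1, hta, htS⟩ := hc' l (Real.exp (-p * l)) hl (Real.exp_pos _) hR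
  set t := c * Real.exp (-p * l) with ht
  have ht0 : 0 < t := by positivity
  have hmain := le_minimaxRelativeMSE_shift (r := r) (β := β) (a₁ := a₁) (a₂ := a₂) (κ := 2)
    (t := t) (a := 1) (B := ε ^ 2 / q * Real.exp (μ ^ 2 + 9 / 2)) (K := K)
    hn hβ0 ha₁ ha₂ hb₁ hb hN hε hμ (by norm_num) ht0 hta htS one_pos (by positivity) ?_ ?_
  · refine le_trans (ENNReal.ofReal_le_ofReal (le_of_eq ?_)) hmain
    rw [← hqdef, ← hc₀, natCast_rpow_eq_exp hn, mul_pow t μ, hμ2, ht, mul_pow, ← Real.exp_nat_mul,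
      show (-1 - 2 * r + 2 * β) * Real.log n = ((2 : ℕ) : ℝ) * (-p * l) by
        rw [hp]; push_cast; ring]
    ring
  · intro u
    have hgq : q ≤ mixDensity ε μ (2 * μ + u) := by
      have : 0 < ε * Real.exp (μ * (2 * μ + u) - μ ^ 2 / 2) := by positivity
      unfold mixDensity; linarith
    calc _ ≤ Real.exp (-(2 * μ + u) ^ 2 / 2) *
          ((ε * Real.exp (μ * (2 * μ + u) - μ ^ 2 / 2)) ^ 2 / q) * Real.exp (2 * |t * u|) := by
          gcongr
      _ = ε ^ 2 / q * (Real.exp (-(2 * μ + u) ^ 2 / 2) *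
          Real.exp (μ * (2 * μ + u) - μ ^ 2 / 2) ^ 2 * Real.exp (2 * |t * u|)) := by ring
      _ = ε ^ 2 / q * Real.exp (μ ^ 2 - u ^ 2 / 2 + 2 * (t * |u|)) := by
          rw [← Real.exp_nat_mul, ← Real.exp_add, ← Real.exp_add, abs_mul, abs_of_pos ht0]
          congr 2; push_cast; ring
      -- Since `t ≤ 1`, it suffices that `3|u| - u²/2 ≤ 9/2`.
      _ ≤ ε ^ 2 / q * Real.exp (μ ^ 2 + 9 / 2 + -1 * |u|) := by
          refine mul_le_mul_of_nonneg_left (Real.exp_le_exp.2 ?_) (by positivity)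
          have h1 : t * |u| ≤ 1 * |u| := mul_le_mul_of_nonneg_right ht1 (abs_nonneg u)
          nlinarith [sq_abs u, sq_nonneg (|u| - 3)]
      _ = _ := by rw [Real.exp_add]; ring
  · apply le_of_eq
    have h1 : (n : ℝ) * ((n : ℝ) ^ (-β)) ^ 2 * Real.exp (μ ^ 2) * Real.exp (-p * l) ^ 2 = 1 := by
      rw [natCast_rpow_eq_exp hn, ← Real.exp_nat_mul, ← Real.exp_nat_mul, hμ2]
      nth_rewrite 1 [hne]
      rw [← Real.exp_add, ← Real.exp_add, ← Real.exp_add, Real.exp_eq_one_iff, hp]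
      push_cast; ring
    calc _ = (n : ℝ) * ((n : ℝ) ^ (-β)) ^ 2 * Real.exp (μ ^ 2) * Real.exp (-p * l) ^ 2 * K := by
          rw [Real.exp_add, ht, hε, hK]; ring
      _ = K := by rw [h1, one_mul]

/-- Exponential decay of the weight of the `χ²`-divergence on both sides of `κ * μ`, the point where
the two components of the mixture are of the same order. -/
theorem gaussian_mul_sq_div_mixDensity_le {b₁ q κ η μ t ε : ℝ} (hε0 : 0 < ε) (hq : 0 < q)
    (hε1 : ε ≤ 1 - q) (hb₁ : 0 < b₁) (hμ0 : 0 < μ) (ht0 : 0 < t) (hη1 : η ≤ 2 - κ)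
    (hη2 : η ≤ κ - 1) (htη : 4 * t ≤ η * μ)
    (hΛ : ∀ u, ε * Real.exp (μ * (κ * μ + u) - μ ^ 2 / 2) = b₁ * Real.exp (μ * u)) (u : ℝ) :
    Real.exp (-(κ * μ + u) ^ 2 / 2) *
      ((ε * Real.exp (μ * (κ * μ + u) - μ ^ 2 / 2)) ^ 2 / mixDensity ε μ (κ * μ + u)) *
        Real.exp (2 * |t * u|) ≤
      (b₁ + b₁ ^ 2 / q) * Real.exp (-(κ * μ) ^ 2 / 2) * Real.exp (-(η * μ / 2) * |u|) := by
  set E := Real.exp (-(κ * μ) ^ 2 / 2) with hE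
  have hg0 := mixDensity_pos hε0 (by linarith) μ (κ * μ + u)
  have hgΛ : b₁ * Real.exp (μ * u) ≤ mixDensity ε μ (κ * μ + u) := by
    rw [← hΛ]; unfold mixDensity; linarith
  have hgq : q ≤ mixDensity ε μ (κ * μ + u) := by
    have : 0 < ε * Real.exp (μ * (κ * μ + u) - μ ^ 2 / 2) := by positivity
    unfold mixDensity; linarith
  have hgauss : Real.exp (-(κ * μ + u) ^ 2 / 2) ≤ E * Real.exp (-(κ * μ * u)) := by
    rw [hE, ← Real.exp_add]
    apply Real.exp_le_exp.2
    nlinarith [sq_nonneg u]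
  have habs : 2 * |t * u| = 2 * t * |u| := by rw [abs_mul, abs_of_pos ht0, mul_assoc]
  rw [hΛ, habs]
  -- To the right the mixture is bounded below by its shifted component, to the left by `q`. This
  -- gives decay rates `(κ - 1)μ` and `(2 - κ)μ`, of which `exp(2t|u|)` consumes at most `ημ/2`.
  rcases le_total 0 u with hu | hu
  · rw [abs_of_nonneg hu]
    calc _ ≤ E * Real.exp (-(κ * μ * u)) *
          ((b₁ * Real.exp (μ * u)) ^ 2 / (b₁ * Real.exp (μ * u))) * Real.exp (2 * t * u) := by
          gcongr
      _ = b₁ * E * (Real.exp (-(κ * μ * u)) * Real.exp (μ * u) * Real.exp (2 * t * u)) := by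
          rw [sq, mul_div_cancel_right₀ _ (by positivity)]; ring
      _ = b₁ * E * Real.exp (-((κ - 1) * μ * u) + 2 * t * u) := by
          rw [← Real.exp_add, ← Real.exp_add]; congr 2; ring
      _ ≤ b₁ * E * Real.exp (-(η * μ / 2) * u) := by
          gcongr
          have h1 : η * μ * u ≤ (κ - 1) * μ * u := by gcongr
          have h2 : 4 * t * u ≤ η * μ * u := by gcongr
          linarith
      _ ≤ _ := by
          gcongr
          have : 0 < b₁ ^ 2 / q := by positivity
          linarith
  · rw [abs_of_nonpos hu]
    calc _ ≤ E * Real.exp (-(κ * μ * u)) *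
          ((b₁ * Real.exp (μ * u)) ^ 2 / q) * Real.exp (2 * t * -u) := by
          gcongr
      _ = b₁ ^ 2 / q * E *
          (Real.exp (-(κ * μ * u)) * Real.exp (μ * u) ^ 2 * Real.exp (2 * t * -u)) := by ring
      _ = b₁ ^ 2 / q * E * Real.exp (-((2 - κ) * μ * -u) + 2 * t * -u) := by
          rw [← Real.exp_nat_mul, ← Real.exp_add, ← Real.exp_add]; congr 2; push_cast; ring
      _ ≤ b₁ ^ 2 / q * E * Real.exp (-(η * μ / 2) * -u) := by
          have hu' : 0 ≤ -u := by linarith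
          gcongr
          have h1 : η * μ * -u ≤ (2 - κ) * μ * -u := by gcongr
          have h2 : 4 * t * -u ≤ η * μ * -u := by gcongr
          linarith
      _ ≤ _ := by gcongr; linarith

theorem mul_sqrt_le_one_add_sq {x : ℝ} (hx : 0 ≤ x) : x * √x ≤ 1 + x ^ 2 := by
  have h1 : √x ^ 2 = x := Real.sq_sqrt hx
  have h2 : √x ≤ (1 + x) / 2 := by nlinarith [sq_nonneg (√x - 1)]
  have h3 : x * √x ≤ x * ((1 + x) / 2) := mul_le_mul_of_nonneg_left h2 hx
  nlinarith [sq_nonneg (x - 1)]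

theorem le_minimaxRelativeMSE_intermediate {r β a₁ a₂ b₁ b₂ : ℝ} (hr0 : 0 < r) (hr1 : r < 1)
    (hβ0 : 1 / 2 < β) (hrβ : r < β) (hβr : β < 3 * r) (hdet : (β + r) ^ 2 / (4 * r) < 1)
    (ha₁ : 0 < a₁) (ha₂ : 0 < a₂) (hb₁ : 0 < b₁) (hb : b₁ < b₂) :
    ∃ C : ℝ, 0 < C ∧ ∀ n : ℕ, 2 ≤ n → b₂ * (n : ℝ) ^ (-β) ≤ 1 →
      ENNReal.ofReal (C * Real.log n ^ (5 / 2 : ℝ) * (n : ℝ) ^ (-1 + (β + r) ^ 2 / (4 * r))) ≤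
        minimaxRelativeMSE n (paramSet r β a₁ a₂ b₁ b₂ n) := by
  have hb₂ : 0 < b₂ := hb₁.trans hb
  have hq : 0 < 1 - b₁ / b₂ := by rw [sub_pos, div_lt_one hb₂]; exact hb
  set p := (1 - (β + r) ^ 2 / (4 * r)) / 2 with hp
  have hp0 : 0 < p := by rw [hp]; linarith
  -- The solution of `(2κ - 1) r = β`, which cancels the powers of `n` in `ε exp(μx - μ²/2)` at `x =
  -- κμ`.
  set κ := (β + r) / (2 * r) with hκ
  have hκ1 : 1 < κ := by rw [hκ, one_lt_div (by positivity)]; linarith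
  have hκ2 : κ < 2 := by rw [hκ, div_lt_iff₀ (by positivity)]; linarith
  have hκβ : (2 * κ - 1) * r = β := by rw [hκ]; field_simp; ring
  have hκp : κ ^ 2 * r = 1 - 2 * p := by rw [hκ, hp]; field_simp; ring
  set η := min (2 - κ) (κ - 1) with hη
  have hη0 : 0 < η := lt_min (by linarith) (by linarith)
  have hη1 : η ≤ 2 - κ := min_le_left _ _
  have hη2 : η ≤ κ - 1 := min_le_right _ _
  -- The value of `μ` at `n = 2`, a lower bound for all `n`, so that one `c` ensures `4t ≤ ημ`
  -- throughout.
  set m₀ := √(2 * r * Real.log 2) with hm₀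
  have hlog2 : 0 < Real.log 2 := Real.log_pos (by norm_num)
  have hm₀0 : 0 < m₀ := by positivity
  obtain ⟨c, hc, hc'⟩ := exists_shift_scale (κ := κ) (S := Real.log (b₂ / b₁)) (τ := η * m₀ / 4)
    (M := 2 * (1 + 2 / p) ^ 2) hr0 hr1 ha₁ hκ1
    (Real.log_pos ((one_lt_div hb₁).2 hb)) (by positivity) (by positivity)
  set q := 1 - b₁ / b₂ with hqdef
  set K := 64 * (b₁ + b₁ ^ 2 / q) * c ^ 2 / η ^ 3 with hK
  set c₀ := (b₁ / b₂ * (κ - 1)) ^ 2 / (16 * Real.exp (K + 2 * b₂ ^ 2 / q)) with hc₀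
  have hκ0 : 0 < κ - 1 := by linarith
  have hc₀0 : 0 < c₀ := by rw [hc₀]; positivity
  clear_value κ η p q K c₀
  refine ⟨c₀ * (c ^ 2 * (2 * r) ^ (5 / 2 : ℝ)), by positivity, fun n hn hN => ?_⟩
  have hn2 : (2 : ℝ) ≤ n := by exact_mod_cast hn
  have hn1 : (1 : ℝ) < n := by linarith
  have hl : 0 < Real.log n := Real.log_pos hn1
  have hne : (n : ℝ) = Real.exp (Real.log n) := (Real.exp_log (by linarith)).symm
  have hl2 : Real.log 2 ≤ Real.log n := Real.log_le_log (by norm_num) hn2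
  set l := Real.log n with hldef
  set μ := √(2 * r * l) with hμ
  have hμ0 : 0 < μ := by positivity
  have hμ2 : μ ^ 2 = 2 * r * l := Real.sq_sqrt (by positivity)
  have hμm : m₀ ≤ μ := Real.sqrt_le_sqrt (by gcongr)
  have hμ5 : μ ^ 5 = (2 * r) ^ (5 / 2 : ℝ) * l ^ (5 / 2 : ℝ) := by
    rw [← Real.mul_rpow (by positivity) hl.le, hμ, Real.sqrt_eq_rpow, ← Real.rpow_natCast,
      ← Real.rpow_mul (by positivity)]
    norm_num
  set ε := b₁ * (n : ℝ) ^ (-β) with hε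
  have hnβ : 0 < (n : ℝ) ^ (-β) := by positivity
  have hε0 : 0 < ε := by rw [hε]; positivity
  have hε1 : ε ≤ 1 - q := by
    calc ε = b₁ / b₂ * (b₂ * (n : ℝ) ^ (-β)) := by rw [hε]; field_simp
      _ ≤ b₁ / b₂ * 1 := by gcongr
      _ = _ := by rw [hqdef]; ring
  clear_value μ ε m₀
  -- The factor `μ * √μ` squares to `μ³` and cancels the `a³` of the `χ²` bound, where `a = ημ/2`.
  set R := Real.exp (-p * l) * (μ * √μ) with hRdef
  have hR0 : 0 < R := by positivity
  have hR : R * (1 + l) ≤ 2 * (1 + 2 / p) ^ 2 := by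
    have h1 : μ * √μ ≤ 2 * (1 + l) := by
      refine (mul_sqrt_le_one_add_sq hμ0.le).trans ?_
      rw [hμ2]
      nlinarith [mul_pos (sub_pos.2 hr1) hl]
    calc R * (1 + l) = Real.exp (-p * l) * (1 + l) * (μ * √μ) := by rw [hRdef]; ring
      _ ≤ Real.exp (-p * l) * (1 + l) * (2 * (1 + l)) := by gcongr
      _ = 2 * (Real.exp (-p * l) * (1 + l) ^ 2) := by ring
      _ ≤ _ := by gcongr; exact exp_neg_mul_mul_sq_le hp0 hl.le
  have hR2 : R ^ 2 = Real.exp (-p * l) ^ 2 * μ ^ 3 := by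
    rw [hRdef, mul_pow, mul_pow, Real.sq_sqrt hμ0.le]; ring
  obtain ⟨ht1, hta, htS⟩ := hc' l R hl hR0 hR
  set t := c * R with ht
  have ht0 : 0 < t := by positivity
  have htη : 4 * t ≤ η * μ := by
    have : η * m₀ ≤ η * μ := by gcongr
    linarith
  clear_value t R
  set E := Real.exp (-(κ * μ) ^ 2 / 2) with hE
  have hΛ : ∀ u, ε * Real.exp (μ * (κ * μ + u) - μ ^ 2 / 2) = b₁ * Real.exp (μ * u) := by
    intro u
    rw [hε, natCast_rpow_eq_exp hn, mul_assoc, ← Real.exp_add]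
    congr 2
    linear_combination ((κ - 1 / 2) : ℝ) * hμ2 + l * hκβ
  have hmain := le_minimaxRelativeMSE_shift (r := r) (β := β) (a₁ := a₁) (a₂ := a₂) (κ := κ)
    (t := t) (a := η * μ / 2) (B := (b₁ + b₁ ^ 2 / q) * E) (K := K)
    hn hβ0 ha₁ ha₂ hb₁ hb hN hε hμ hκ1 ht0 hta (by rw [hμ]; exact htS)
    (by positivity) (by positivity) ?_ ?_
  · refine le_trans (ENNReal.ofReal_le_ofReal (le_of_eq ?_)) hmain
    rw [← hqdef, ← hc₀, natCast_rpow_eq_exp hn, mul_pow t μ, ht, mul_pow, hR2, ← Real.exp_nat_mul,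
      show (-1 + (β + r) ^ 2 / (4 * r)) * Real.log n = ((2 : ℕ) : ℝ) * (-p * l) by
        rw [hp]; push_cast; ring]
    linear_combination (-c₀ * c ^ 2 * Real.exp (((2 : ℕ) : ℝ) * (-p * l))) * hμ5
  · exact gaussian_mul_sq_div_mixDensity_le hε0 hq hε1 hb₁ hμ0 ht0 hη1 hη2 htη hΛ
  · apply le_of_eq
    have h1 : (n : ℝ) * E * Real.exp (-p * l) ^ 2 = 1 := by
      rw [← Real.exp_nat_mul, hE, mul_pow, hμ2]
      nth_rewrite 1 [hne]
      rw [← Real.exp_add, ← Real.exp_add, Real.exp_eq_one_iff]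
      push_cast
      linear_combination (-l) * hκp
    calc _ = (n : ℝ) * E * Real.exp (-p * l) ^ 2 * K := by
          rw [ht, mul_pow, hR2, hK]; field_simp; ring
      _ = K := by rw [h1, one_mul]

/-! ### The detection boundary and conclusion -/

theorem sub_half_le_detectionBoundary {β : ℝ} (hβ1 : β < 1) :
    β - 1 / 2 ≤ detectionBoundary β := by
  unfold detectionBoundary
  split_ifs
  · exact le_rfl
  · have := Real.sq_sqrt (show 0 ≤ 1 - β by linarith)
    -- With `s = √(1 - β)`, the gap `(1 - s)² - (1/2 - s²)` equals `2(s - 1/2)²`.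
    nlinarith [sq_nonneg (√(1 - β) - 1 / 2)]

/-- The conclusion amounts to `β + r < 2√r`, that is `(1 - √r)² < 1 - β`, which follows from `1 -
√(1 - β) < √r`. -/
theorem add_sq_div_lt_one_of_detectionBoundary_lt {r β : ℝ} (hr0 : 0 < r)
    (hβ1 : β < 1) (hrβ : r < β) (hβr : β < 3 * r) (hdet : detectionBoundary β < r) :
    (β + r) ^ 2 / (4 * r) < 1 := by
  set s := √(1 - β) with hs
  have hs2 : s ^ 2 = 1 - β := Real.sq_sqrt (by linarith)
  have hs0 : 0 < s := Real.sqrt_pos.2 (by linarith)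
  have hs1 : s < 1 := by nlinarith
  have hrs : (1 - s) ^ 2 < r := by
    unfold detectionBoundary at hdet
    split_ifs at hdet with h
    -- For `β ≤ 3/4`, `r > β/3 = (1 - s²)/3 ≥ (1 - s)²`, the last step because `s ≥ 1/2`.
    · have : 1 / 2 ≤ s := Real.le_sqrt_of_sq_le (by linarith)
      nlinarith
    · exact hdet
  have h1 : 1 - s < √r := Real.lt_sqrt_of_sq_lt hrs
  have h2 : √r ^ 2 = r := Real.sq_sqrt hr0.le
  have h3 : 0 < √r := Real.sqrt_pos.2 hr0
  have h4 : √r < 1 := by nlinarith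
  have h5 : (1 - √r) ^ 2 < s ^ 2 := pow_lt_pow_left₀ (by linarith) (by linarith) two_ne_zero
  have h6 : β + r < 2 * √r := by nlinarith
  rw [div_lt_one (by positivity)]
  calc (β + r) ^ 2 < (2 * √r) ^ 2 := pow_lt_pow_left₀ h6 (by linarith) two_ne_zero
    _ = 4 * r := by rw [mul_pow, h2]; norm_num

theorem theorem4p2 (r β a₁ a₂ b₁ b₂ : ℝ)
    (hr0 : 0 < r) (hr1 : r < 1) (hβ0 : 1 / 2 < β) (hβ1 : β < 1)
    (hdet : detectionBoundary β < r)
    (ha₁ : 0 < a₁) (ha₂ : 0 < a₂) (hb₁ : 0 < b₁) (hb : b₁ < b₂) :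
    ∃ C : ℝ, 0 < C ∧ ∀ n : ℕ, 2 ≤ n → b₂ * (n : ℝ) ^ (-β) ≤ 1 →
      (3 * r ≤ β →
        ENNReal.ofReal (C * Real.log n * (n : ℝ) ^ (-1 - 2 * r + 2 * β)) ≤
          minimaxRelativeMSE n (paramSet r β a₁ a₂ b₁ b₂ n)) ∧
      (r < β → β < 3 * r →
        ENNReal.ofReal (C * Real.log n ^ (5 / 2 : ℝ) *
            (n : ℝ) ^ (-1 + (β + r) ^ 2 / (4 * r))) ≤
          minimaxRelativeMSE n (paramSet r β a₁ a₂ b₁ b₂ n)) ∧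
      (β ≤ r →
        ENNReal.ofReal (C * (n : ℝ) ^ (-1 + β)) ≤
          minimaxRelativeMSE n (paramSet r β a₁ a₂ b₁ b₂ n)) := by
  -- The regime depends on `r` and `β` alone, so it is settled before `C` is chosen.
  rcases le_or_gt (3 * r) β with h1 | h1
  · have hrβ := (sub_half_le_detectionBoundary hβ1).trans_lt hdet
    obtain ⟨C, hC, h⟩ := le_minimaxRelativeMSE_sparse hr0 hr1 hβ0 hrβ ha₁ ha₂ hb₁ hb
    exact ⟨C, hC, fun n hn hN => ⟨fun _ => h n hn hN, fun _ h3 => absurd h3 (not_lt.2 h1),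
      fun h3 => by linarith⟩⟩
  rcases le_or_gt β r with h2 | h2
  · obtain ⟨C, hC, h⟩ := le_minimaxRelativeMSE_scale (r := r) hβ1 ha₁ ha₂ hb₁ hb
    exact ⟨C, hC, fun n hn hN => ⟨fun h3 => absurd h3 (not_le.2 h1),
      fun h3 => absurd h3 (not_lt.2 h2), fun _ => h n hn hN⟩⟩
  · obtain ⟨C, hC, h⟩ := le_minimaxRelativeMSE_intermediate hr0 hr1 hβ0 h2 h1
      (add_sq_div_lt_one_of_detectionBoundary_lt hr0 hβ1 h2 h1 hdet) ha₁ ha₂ hb₁ hb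
    exact ⟨C, hC, fun n hn hN => ⟨fun h3 => absurd h3 (not_le.2 h1), fun _ _ => h n hn hN,
      fun h3 => absurd h3 (not_le.2 h2)⟩⟩
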